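/- Let $\mathbb D=\{z\in\mathbb C:|z|<1\}$. A set $E\subset\mathbb D$ is called non-Blaschke if it contains a sequence of pairwise distinct points $(z_j)_{j\ge1}$ with $\sum_{j}(1-|z_j|)=\infty$. For $1\le p\le\infty$ let $\mathcal A^p$ be the set of all holomorphic functions $f$ on $\mathbb D$ with $\|f\|_{H^p}=1$, where $\|f\|_{H^p}=\lim_{r\uparrow1}\left(\frac1{2\pi}\int_0^{2\pi}|f(re^{i\theta})|^p\,d\theta\right)^{1/p}$ for $p<\infty$ and $\|f\|_{H^\infty}=\lim_{r\uparrow1}\sup_\theta|f(re^{i\theta})|$. For $E\subset\mathbb D$, $\varepsilon>0$ and $0<R<1$ put $$D_p(E,\varepsilon,R)=\sup\Big\{\sup_{|z|\le R}|f(z)|:\ f\in\mathcal A^p,\ (1-|\zeta|)\,|f(\zeta)|\le\varepsilon\ \text{ for all }\zeta\in E\Big\}.$$ For $n\ge1$ and $Z_n=(z_1,\dots,z_n)\in E^n$ (repetitions allowed) let $B(Z_n;z)=\prod_{j=1}^n\frac{z-z_j}{1-\overline{z_j}z}$, and put $$g(E,\varepsilon,R)=\sup\Big\{\sup_{|z|\le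 R}|B(Z_n;z)|:\ n\ge1,\ Z_n\in E^n,\ (1-|\zeta|)\,|B(Z_n;\zeta)|\le\varepsilon\ \text{ for all }\zeta\in E\Big\}.$$ **Theorem.** There is an absolute constant $\sigma>0$ such that for every $1\le p\le\infty$ and every $0<R<1$ there are constants $K,\alpha,\varepsilon_0>0$, depending only on $p$ and $R$, such that for every non-Blaschke set $E\subset\mathbb D$ and every $0<\varepsilon<\varepsilon_0$, $$g(E,\varepsilon,R)\ \le\ D_p(E,\varepsilon,R)\ \le\ K\cdot g(E,\varepsilon^{\sigma},R)^{\alpha}.$$ -/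

import Mathlib

open scoped ENNReal Topology

noncomputable section

namespace HardyBlaschke

/-- `E` is a non-Blaschke subset of the open unit disc: it is contained in the disc and it contains
a sequence of pairwise distinct points `z_j` with `∑ (1 - |z_j|) = ∞`. -/
def IsNonBlaschke (E : Set ℂ) : Prop :=
  E ⊆ Metric.ball 0 1 ∧
    ∃ z : ℕ → ℂ, Function.Injective z ∧ (∀ j, z j ∈ E) ∧ ¬ Summable fun j => 1 - ‖z j‖

/-- The normalized Lebesgue measure `dθ / 2π` on `(0, 2π]`. -/
def angleMeasure : MeasureTheory.Measure ℝ :=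
  (ENNReal.ofReal (2 * Real.pi))⁻¹ • MeasureTheory.volume.restrict (Set.Ioc 0 (2 * Real.pi))

/-- The `L^p` mean of `f` over the circle of radius `r`, that is
`((1 / 2π) ∫₀^{2π} |f (r e^{iθ})|^p dθ)^{1/p}` for `1 ≤ p < ∞`, and the (essential) supremum of
`|f (r e^{iθ})|` over `θ` for `p = ∞`. -/
def circleMean (p : ℝ≥0∞) (f : ℂ → ℂ) (r : ℝ) : ℝ≥0∞ :=
  MeasureTheory.eLpNorm (fun θ : ℝ => f ((r : ℂ) * Complex.exp ((θ : ℂ) * Complex.I))) p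
    angleMeasure

/-- The Hardy norm `lim_{r ↑ 1} circleMean p f r` of `f` exists and equals `N`. -/
def HasHardyNorm (p : ℝ≥0∞) (f : ℂ → ℂ) (N : ℝ≥0∞) : Prop :=
  Filter.Tendsto (circleMean p f) (𝓝[<] (1 : ℝ)) (𝓝 N)

/-- The unit sphere of the Hardy space `H^p`: holomorphic functions on the open unit disc with
Hardy norm `1`. (Values outside the disc play no role.) -/
def hardySphere (p : ℝ≥0∞) : Set (ℂ → ℂ) :=
  {f | DifferentiableOn ℂ f (Metric.ball 0 1) ∧ HasHardyNorm p f 1}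

/-- `sup_{|z| ≤ R} |f z|`, with values in `[0, ∞]`. -/
def supOnDisc (R : ℝ) (f : ℂ → ℂ) : ℝ≥0∞ :=
  ⨆ z ∈ Metric.closedBall (0 : ℂ) R, ‖f z‖ₑ

/-- The quantity `D_p(E, ε, R)`, with values in `[0, ∞]`. -/
def extremalHardy (p : ℝ≥0∞) (E : Set ℂ) (ε R : ℝ) : ℝ≥0∞ :=
  ⨆ f ∈ {f : ℂ → ℂ | f ∈ hardySphere p ∧ ∀ ζ ∈ E, (1 - ‖ζ‖) * ‖f ζ‖ ≤ ε}, supOnDisc R f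

/-- The finite Blaschke product `∏_j (w - z_j) / (1 - conj z_j * w)` with zeros `z_1, …, z_n`,
repetitions being allowed. -/
def blaschke {n : ℕ} (Z : Fin n → ℂ) (w : ℂ) : ℂ :=
  ∏ j, (w - Z j) / (1 - (starRingEnd ℂ) (Z j) * w)

/-- The weighted finite Blaschke product, with the weight `q(w) = 1 - |w|`. -/
def weightedBlaschke {n : ℕ} (Z : Fin n → ℂ) (w : ℂ) : ℂ :=
  ((1 - ‖w‖ : ℝ) : ℂ) * blaschke Z w

/-- The quantity `g(E, ε, R)`, with values in `[0, ∞]`: the supremum of `sup_{|z| ≤ R} |B(Z_n; z)|`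
over `n ≥ 1` and `Z_n ∈ E^n` such that `|B_q(Z_n; ζ)| ≤ ε` for all `ζ ∈ E`. -/
def extremalBlaschke (E : Set ℂ) (ε R : ℝ) : ℝ≥0∞ :=
  ⨆ (n : ℕ) (_ : 1 ≤ n) (Z : Fin n → ℂ) (_ : ∀ j, Z j ∈ E)
    (_ : ∀ ζ ∈ E, ‖weightedBlaschke Z ζ‖ ≤ ε), supOnDisc R (blaschke Z)

end HardyBlaschke

end

namespace HardyBlaschke

/-- The Blaschke factor with zero `a`. -/
noncomputable def blaschkeFactor (a w : ℂ) : ℂ := (w - a) / (1 - (starRingEnd ℂ) a * w)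

lemma one_sub_norm_mul_le (a w : ℂ) : 1 - ‖a‖ * ‖w‖ ≤ ‖1 - (starRingEnd ℂ) a * w‖ := by
  have := norm_sub_norm_le (1 : ℂ) ((starRingEnd ℂ) a * w)
  simpa using this

lemma one_sub_conj_mul_ne_zero {a w : ℂ} (ha : ‖a‖ < 1) (hw : ‖w‖ ≤ 1) :
    1 - (starRingEnd ℂ) a * w ≠ 0 := by
  have := one_sub_norm_mul_le a w
  have h2 : ‖a‖ * ‖w‖ < 1 := by nlinarith [norm_nonneg a, norm_nonneg w]
  exact norm_pos_iff.1 (by linarith)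

lemma one_sub_normSq_blaschkeFactor {a w : ℂ} (ha : ‖a‖ < 1) (hw : ‖w‖ ≤ 1) :
    1 - ‖blaschkeFactor a w‖ ^ 2 =
      (1 - ‖a‖ ^ 2) * (1 - ‖w‖ ^ 2) / ‖1 - (starRingEnd ℂ) a * w‖ ^ 2 := by
  have hne := one_sub_conj_mul_ne_zero ha hw
  have hpos : ‖1 - (starRingEnd ℂ) a * w‖ ^ 2 ≠ 0 := by simpa using hne
  rw [blaschkeFactor, norm_div, div_pow, eq_div_iff hpos, sub_mul, div_mul_cancel₀ _ hpos]
  simp only [Complex.sq_norm, Complex.normSq_apply, Complex.sub_re, Complex.sub_im, Complex.mul_re,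
    Complex.mul_im, Complex.conj_re, Complex.conj_im, Complex.one_re, Complex.one_im]
  ring

lemma norm_blaschkeFactor_le_one {a w : ℂ} (ha : ‖a‖ < 1) (hw : ‖w‖ ≤ 1) :
    ‖blaschkeFactor a w‖ ≤ 1 := by
  have h := one_sub_normSq_blaschkeFactor ha hw
  have h1 : 0 ≤ (1 - ‖a‖ ^ 2) * (1 - ‖w‖ ^ 2) / ‖1 - (starRingEnd ℂ) a * w‖ ^ 2 := by
    have : 0 ≤ 1 - ‖a‖ ^ 2 := by nlinarith [norm_nonneg a]
    have : 0 ≤ 1 - ‖w‖ ^ 2 := by nlinarith [norm_nonneg w]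
    positivity
  nlinarith [norm_nonneg (blaschkeFactor a w)]

lemma norm_blaschkeFactor_comm (a w : ℂ) : ‖blaschkeFactor a w‖ = ‖blaschkeFactor w a‖ := by
  rw [blaschkeFactor, blaschkeFactor, norm_div, norm_div, norm_sub_rev w a,
    ← Complex.norm_conj (1 - (starRingEnd ℂ) a * w)]
  simp [mul_comm]

lemma blaschkeFactor_self (a : ℂ) : blaschkeFactor a a = 0 := by simp [blaschkeFactor]

lemma blaschkeFactor_ne_zero {a w : ℂ} (ha : ‖a‖ < 1) (hw : ‖w‖ ≤ 1) (h : w ≠ a) :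
    blaschkeFactor a w ≠ 0 :=
  div_ne_zero (sub_ne_zero.2 h) (one_sub_conj_mul_ne_zero ha hw)

/-- Near the unit circle a Blaschke factor is close to unimodular. -/
lemma le_norm_blaschkeFactor {a w : ℂ} (ha : ‖a‖ < 1) (hw : ‖w‖ ≤ 1) :
    1 - (1 - ‖w‖ ^ 2) / (1 - ‖a‖) ^ 2 ≤ ‖blaschkeFactor a w‖ := by
  have h := one_sub_normSq_blaschkeFactor ha hw
  have h1 : 1 - ‖a‖ ≤ ‖1 - (starRingEnd ℂ) a * w‖ :=
    le_trans (by nlinarith [norm_nonneg a]) (one_sub_norm_mul_le a w)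
  have h2 : (1 - ‖a‖ ^ 2) * (1 - ‖w‖ ^ 2) / ‖1 - (starRingEnd ℂ) a * w‖ ^ 2 ≤
      (1 - ‖w‖ ^ 2) / (1 - ‖a‖) ^ 2 := by
    have h4 : 0 ≤ 1 - ‖w‖ ^ 2 := by nlinarith [norm_nonneg w]
    have h5 : 0 < 1 - ‖a‖ := by linarith
    gcongr
    nlinarith [sq_nonneg ‖a‖]
  nlinarith [norm_blaschkeFactor_le_one ha hw, norm_nonneg (blaschkeFactor a w)]

/-- Distinct points of a compact part of the disc are uniformly close in the pseudohyperbolic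
metric. -/
lemma normSq_blaschkeFactor_le {a w : ℂ} {q : ℝ} (hq : 0 ≤ q) (ha : ‖a‖ < 1) (hw : ‖w‖ < 1)
    (hqa : q ≤ 1 - ‖a‖) (hqw : q ≤ 1 - ‖w‖) :
    ‖blaschkeFactor a w‖ ^ 2 ≤ 1 - q ^ 2 / 4 := by
  have h := one_sub_normSq_blaschkeFactor ha hw.le
  have h1 : ‖1 - (starRingEnd ℂ) a * w‖ ≤ 2 := by
    calc _ ≤ ‖(1 : ℂ)‖ + ‖(starRingEnd ℂ) a * w‖ := norm_sub_le _ _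
      _ ≤ 2 := by
        simp only [norm_one, norm_mul, RCLike.norm_conj]
        nlinarith [norm_nonneg a, norm_nonneg w]
  have h2 : q ^ 2 / 4 ≤ (1 - ‖a‖ ^ 2) * (1 - ‖w‖ ^ 2) / ‖1 - (starRingEnd ℂ) a * w‖ ^ 2 := by
    have h3 : 0 < ‖1 - (starRingEnd ℂ) a * w‖ :=
      norm_pos_iff.2 (one_sub_conj_mul_ne_zero ha hw.le)
    rw [div_le_div_iff₀ (by norm_num) (by positivity)]
    have h4 : ‖1 - (starRingEnd ℂ) a * w‖ ^ 2 ≤ 4 := by nlinarith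
    have h5 : q ≤ 1 - ‖a‖ ^ 2 := by nlinarith [norm_nonneg a]
    have h6 : q ≤ 1 - ‖w‖ ^ 2 := by nlinarith [norm_nonneg w]
    have h7 : q ^ 2 ≤ (1 - ‖a‖ ^ 2) * (1 - ‖w‖ ^ 2) := by nlinarith
    nlinarith [sq_nonneg q]
  linarith

lemma le_norm_blaschkeFactor_of_norm_sub_ge {a w : ℂ} (ha : ‖a‖ < 1) (hw : ‖w‖ ≤ 1) {c : ℝ}
    (hc : c ≤ ‖w - a‖) : c / 2 ≤ ‖blaschkeFactor a w‖ := by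
  have h1 : ‖1 - (starRingEnd ℂ) a * w‖ ≤ 2 := by
    calc _ ≤ ‖(1 : ℂ)‖ + ‖(starRingEnd ℂ) a * w‖ := norm_sub_le _ _
      _ ≤ 2 := by
        simp only [norm_one, norm_mul, RCLike.norm_conj]
        nlinarith [norm_nonneg a, norm_nonneg w]
  have h3 : 0 < ‖1 - (starRingEnd ℂ) a * w‖ := norm_pos_iff.2 (one_sub_conj_mul_ne_zero ha hw)
  rw [blaschkeFactor, norm_div, div_le_div_iff₀ (by norm_num) h3]
  nlinarith [norm_nonneg (w - a)]

lemma differentiableOn_blaschkeFactor {a : ℂ} (ha : ‖a‖ < 1) :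
    DifferentiableOn ℂ (blaschkeFactor a) (Metric.ball 0 1) := by
  unfold blaschkeFactor
  refine DifferentiableOn.div (by fun_prop) (by fun_prop) fun w hw => ?_
  exact one_sub_conj_mul_ne_zero ha (by simpa using (mem_ball_zero_iff.1 hw).le)

/-- The finite Blaschke product with simple zeros at the points of `S`. -/
noncomputable def blaschkeProd (S : Finset ℂ) (w : ℂ) : ℂ := ∏ a ∈ S, blaschkeFactor a w

lemma differentiableOn_blaschkeProd {S : Finset ℂ} (hS : ∀ a ∈ S, ‖a‖ < 1) :
    DifferentiableOn ℂ (blaschkeProd S) (Metric.ball 0 1) := by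
  unfold blaschkeProd
  exact DifferentiableOn.fun_finsetProd fun a ha => differentiableOn_blaschkeFactor (hS a ha)

lemma norm_blaschkeProd_le_one {S : Finset ℂ} (hS : ∀ a ∈ S, ‖a‖ < 1) {w : ℂ} (hw : ‖w‖ ≤ 1) :
    ‖blaschkeProd S w‖ ≤ 1 := by
  rw [blaschkeProd, norm_prod]
  exact Finset.prod_le_one (fun _ _ => norm_nonneg _)
    fun a ha => norm_blaschkeFactor_le_one (hS a ha) hw

lemma blaschkeProd_eq_zero {S : Finset ℂ} {a : ℂ} (ha : a ∈ S) : blaschkeProd S a = 0 :=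
  Finset.prod_eq_zero ha (blaschkeFactor_self a)

/-- A finite Blaschke product tends to unimodular values at the unit circle. -/
lemma eventually_le_norm_prod_blaschkeFactor {ι : Type*} (s : Finset ι) (Z : ι → ℂ)
    (hZ : ∀ i ∈ s, ‖Z i‖ < 1) {δ : ℝ} (hδ : δ < 1) :
    ∀ᶠ r in 𝓝[<] (1 : ℝ), ∀ w : ℂ, ‖w‖ = r → δ ≤ ‖∏ i ∈ s, blaschkeFactor (Z i) w‖ := by
  have hfac : ∀ i, Filter.Tendsto (fun r : ℝ => 1 - (1 - r ^ 2) / (1 - ‖Z i‖) ^ 2) (𝓝[<] (1 : ℝ))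
      (𝓝 1) := fun i => by
    have : Continuous fun r : ℝ => 1 - (1 - r ^ 2) / (1 - ‖Z i‖) ^ 2 := by fun_prop
    simpa using (this.tendsto 1).mono_left nhdsWithin_le_nhds
  have hprod : Filter.Tendsto (fun r : ℝ => ∏ i ∈ s, (1 - (1 - r ^ 2) / (1 - ‖Z i‖) ^ 2))
      (𝓝[<] (1 : ℝ)) (𝓝 1) := by
    simpa using tendsto_finsetProd s fun i _ => hfac i
  have hnonneg : ∀ᶠ r in 𝓝[<] (1 : ℝ), ∀ i ∈ s, 0 < 1 - (1 - r ^ 2) / (1 - ‖Z i‖) ^ 2 :=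
    (Filter.eventually_all_finset s).2 fun i _ => (hfac i).eventually (lt_mem_nhds one_pos)
  filter_upwards [hprod.eventually (lt_mem_nhds hδ), hnonneg, self_mem_nhdsWithin]
    with r h1 h2 h3 w hw
  rw [norm_prod]
  refine h1.le.trans (Finset.prod_le_prod (fun i hi => (h2 i hi).le) fun i hi => ?_)
  rw [← hw]
  exact le_norm_blaschkeFactor (hZ i hi) (hw.trans_lt h3).le

/-- A holomorphic function vanishing on a finite set is divisible by the Blaschke product. -/
lemma exists_eq_blaschkeProd_mul {S : Finset ℂ} (hS : ∀ a ∈ S, ‖a‖ < 1) {f : ℂ → ℂ}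
    (hf : DifferentiableOn ℂ f (Metric.ball 0 1)) (h0 : ∀ a ∈ S, f a = 0) :
    ∃ h : ℂ → ℂ, DifferentiableOn ℂ h (Metric.ball 0 1) ∧
      ∀ z ∈ Metric.ball (0 : ℂ) 1, f z = blaschkeProd S z * h z := by
  induction S using Finset.induction_on generalizing f with
  | empty => exact ⟨f, hf, by simp [blaschkeProd]⟩
  | insert a S haS ih =>
    have ha : ‖a‖ < 1 := hS a (Finset.mem_insert_self _ _)
    have hS' : ∀ b ∈ S, ‖b‖ < 1 := fun b hb => hS b (Finset.mem_insert_of_mem hb)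
    have hfa : f a = 0 := h0 a (Finset.mem_insert_self _ _)
    have hmem : Metric.ball (0 : ℂ) 1 ∈ 𝓝 a := Metric.isOpen_ball.mem_nhds (by simpa using ha)
    have hd := (Complex.differentiableOn_dslope hmem).2 hf
    have hfac : ∀ z, f z = (z - a) * dslope f a z := fun z => by
      have := sub_smul_dslope f a z
      simpa [hfa] using this.symm
    obtain ⟨h, hh, hfh⟩ := ih hS' hd fun b hb => by
      have hne : b - a ≠ 0 := sub_ne_zero.2 fun e => haS (e ▸ hb)
      have := hfac b
      rw [h0 b (Finset.mem_insert_of_mem hb)] at this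
      exact (mul_eq_zero.1 this.symm).resolve_left hne
    refine ⟨fun z => (1 - (starRingEnd ℂ) a * z) * h z, by fun_prop, fun z hz => ?_⟩
    have hne := one_sub_conj_mul_ne_zero ha (mem_ball_zero_iff.1 hz).le
    have hprod : blaschkeProd (insert a S) z = blaschkeFactor a z * blaschkeProd S z :=
      Finset.prod_insert haS
    rw [hfac z, hfh z hz, hprod, blaschkeFactor]
    beta_reduce
    generalize 1 - (starRingEnd ℂ) a * z = D at *
    field_simp

/-- Hadamard's three circles theorem, with the estimate extended to the whole disc. -/
lemma norm_le_of_three_circles {f : ℂ → ℂ} (hf : DifferentiableOn ℂ f (Metric.ball 0 1))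
    {r R ρ a b : ℝ} (hr : 0 < r) (hrR : r < R) (hRρ : R < ρ) (hρ : ρ < 1)
    (ha : ∀ z, ‖z‖ = r → ‖f z‖ ≤ a) (hb : ∀ z, ‖z‖ = ρ → ‖f z‖ ≤ b) {z : ℂ} (hz : ‖z‖ ≤ R) :
    ‖f z‖ ≤ a ^ (1 - Real.log (R / r) / Real.log (ρ / r)) *
      b ^ (Real.log (R / r) / Real.log (ρ / r)) := by
  have hR : 0 < R := hr.trans hrR
  have hρ0 : 0 < ρ := hR.trans hRρ
  have hball : Metric.closedBall (0 : ℂ) R ⊆ Metric.ball 0 1 :=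
    Metric.closedBall_subset_ball (hRρ.trans hρ)
  refine Complex.norm_le_of_forall_mem_frontier_norm_le (U := Metric.ball (0 : ℂ) R)
    Metric.isBounded_ball ((hf.mono hball).diffContOnCl_ball subset_rfl) (fun w hw => ?_)
    (by rw [closure_ball _ hR.ne']; simpa using hz)
  have hw : ‖w‖ = R := by
    rw [frontier_ball _ hR.ne'] at hw
    simpa using hw
  have hw0 : w ≠ 0 := norm_pos_iff.1 (hw ▸ hR)
  have hlog : Real.log r < Real.log ρ := Real.log_lt_log hr (hrR.trans hRρ)
  have hexp : ∀ u : ℂ, u.re ≤ Real.log ρ → ‖Complex.exp u‖ ≤ ρ := fun u hu => by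
    rw [Complex.norm_exp, ← Real.exp_log hρ0]
    exact Real.exp_le_exp.2 hu
  have hmaps : ∀ u : ℂ, u.re ≤ Real.log ρ → Complex.exp u ∈ Metric.ball (0 : ℂ) 1 := fun u hu =>
    mem_ball_zero_iff.2 ((hexp u hu).trans_lt hρ)
  have hdiff : ∀ u : ℂ, u.re ≤ Real.log ρ → DifferentiableAt ℂ (fun u => f (Complex.exp u)) u :=
    fun u hu => (hf.differentiableAt (Metric.isOpen_ball.mem_nhds (hmaps u hu))).comp u
      Complex.differentiable_exp.differentiableAt
  have key := Complex.HadamardThreeLines.norm_le_interp_of_mem_verticalClosedStrip'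
    (f := fun u => f (Complex.exp u)) (z := Complex.log w) (a := a) (b := b) hlog ?_ ?_ ?_ ?_ ?_
  · rw [Complex.exp_log hw0, Complex.log_re, hw, ← Real.log_div hR.ne' hr.ne',
      ← Real.log_div hρ0.ne' hr.ne'] at key
    exact key
  · simp only [Complex.HadamardThreeLines.verticalClosedStrip, Set.mem_preimage, Complex.log_re, hw]
    exact ⟨Real.log_le_log hr hrR.le, Real.log_le_log hR hRρ.le⟩
  · refine ⟨fun u hu => (hdiff u hu.2.le).differentiableWithinAt, fun u hu => ?_⟩
    have hu' : u ∈ Complex.re ⁻¹' Set.Iic (Real.log ρ) :=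
      closure_minimal (fun v hv => le_of_lt hv.2) (isClosed_Iic.preimage Complex.continuous_re) hu
    exact (hdiff u hu').continuousAt.continuousWithinAt
  · obtain ⟨M, hM⟩ := (isCompact_closedBall (0 : ℂ) ρ).exists_bound_of_continuousOn
      (hf.continuousOn.mono (Metric.closedBall_subset_ball hρ))
    refine ⟨M, ?_⟩
    rintro _ ⟨u, hu, rfl⟩
    exact hM _ (mem_closedBall_zero_iff.2 (hexp u hu.2))
  · intro u hu
    refine ha _ ?_
    rw [Complex.norm_exp, show u.re = Real.log r from hu, Real.exp_log hr]
  · intro u hu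
    refine hb _ ?_
    rw [Complex.norm_exp, show u.re = Real.log ρ from hu, Real.exp_log hρ0]

instance : MeasureTheory.IsProbabilityMeasure angleMeasure := ⟨by
  have h : ENNReal.ofReal (2 * Real.pi) ≠ 0 := by simpa using Real.pi_pos
  simpa [angleMeasure] using ENNReal.inv_mul_cancel h ENNReal.ofReal_ne_top⟩

lemma lintegral_circle_eq (h : ℂ → ℂ) (r : ℝ) :
    ∫⁻ θ in Set.Ioc 0 (2 * Real.pi), ‖h ((r : ℂ) * Complex.exp ((θ : ℂ) * Complex.I))‖ₑ =
      ENNReal.ofReal (2 * Real.pi) * circleMean 1 h r := by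
  have hpi : ENNReal.ofReal (2 * Real.pi) ≠ 0 := by simpa using Real.pi_pos
  rw [circleMean, MeasureTheory.eLpNorm_one_eq_lintegral_enorm, angleMeasure,
    MeasureTheory.lintegral_smul_measure, smul_eq_mul, ← mul_assoc,
    ENNReal.mul_inv_cancel hpi ENNReal.ofReal_ne_top, one_mul]

/-- Pointwise bound of a holomorphic function by its mean over a circle. -/
lemma norm_le_of_circleMean_le {h : ℂ → ℂ} (hh : DifferentiableOn ℂ h (Metric.ball 0 1))
    {r N : ℝ} (hr : 0 < r) (hr1 : r < 1) (hN0 : 0 ≤ N)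
    (hN : circleMean 1 h r ≤ ENNReal.ofReal N) {z : ℂ} (hz : ‖z‖ < r) :
    ‖h z‖ ≤ N / (r - ‖z‖) := by
  have hd : DiffContOnCl ℂ h (Metric.ball 0 r) :=
    (hh.mono (Metric.closedBall_subset_ball hr1)).diffContOnCl_ball subset_rfl
  have hc := hd.circleIntegral_sub_inv_smul (w := z) (by simpa using hz)
  have hgap : 0 < r - ‖z‖ := by linarith
  have hbound : ‖∮ w in C(0, r), (w - z)⁻¹ • h w‖ₑ ≤
      ENNReal.ofReal (1 / (r - ‖z‖)) * (ENNReal.ofReal (2 * Real.pi) * circleMean 1 h r) := by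
    rw [circleIntegral, intervalIntegral.integral_of_le Real.two_pi_pos.le]
    refine (MeasureTheory.enorm_integral_le_lintegral_enorm _).trans ?_
    rw [← lintegral_circle_eq, ← MeasureTheory.lintegral_const_mul' _ _ ENNReal.ofReal_ne_top]
    refine MeasureTheory.lintegral_mono fun θ => ?_
    simp only [← circleMap_zero]
    rw [← ofReal_norm, ← ofReal_norm, ← ENNReal.ofReal_mul (by positivity)]
    refine ENNReal.ofReal_le_ofReal ?_
    have h1 : r - ‖z‖ ≤ ‖circleMap 0 r θ - z‖ := by
      have := norm_sub_norm_le (circleMap 0 r θ) z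
      rwa [norm_circleMap_zero, abs_of_pos hr] at this
    rw [norm_smul, norm_smul, ← mul_assoc, deriv_circleMap, norm_mul, norm_circleMap_zero,
      Complex.norm_I, mul_one, abs_of_pos hr, norm_inv, ← div_eq_mul_inv]
    gcongr
  rw [hc] at hbound
  have h2 : ENNReal.ofReal ‖(2 * Real.pi * Complex.I : ℂ) • h z‖ ≤
      ENNReal.ofReal (1 / (r - ‖z‖) * (2 * Real.pi * N)) := by
    rw [ofReal_norm, ENNReal.ofReal_mul (by positivity), ENNReal.ofReal_mul Real.two_pi_pos.le]
    exact hbound.trans (by gcongr)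
  have h3 := (ENNReal.ofReal_le_ofReal_iff (by have := Real.pi_pos; positivity)).1 h2
  rw [norm_smul] at h3
  have h4 : ‖(2 * Real.pi * Complex.I : ℂ)‖ = 2 * Real.pi := by
    simp [abs_of_pos Real.pi_pos]
  rw [h4] at h3
  have h5 : 2 * Real.pi * ‖h z‖ ≤ 2 * Real.pi * (N / (r - ‖z‖)) := h3.trans_eq (by ring)
  exact le_of_mul_le_mul_left h5 Real.two_pi_pos

lemma norm_le_of_eventually_circleMean_le {h : ℂ → ℂ}
    (hh : DifferentiableOn ℂ h (Metric.ball 0 1)) {N ρ : ℝ} (hN0 : 0 ≤ N)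
    (hN : ∀ᶠ r in 𝓝[<] (1 : ℝ), circleMean 1 h r ≤ ENNReal.ofReal N)
    (hρ : ρ < 1) {z : ℂ} (hz : ‖z‖ ≤ ρ) : ‖h z‖ ≤ 2 * N / (1 - ρ) := by
  have hlt : (1 + ρ) / 2 < 1 := by linarith
  obtain ⟨r, h1, h2, h3⟩ := (hN.and (Ioo_mem_nhdsLT hlt)).exists
  have hz0 := norm_nonneg z
  refine (norm_le_of_circleMean_le hh (by linarith) h3 hN0 h1 (by linarith)).trans ?_
  rw [div_le_div_iff₀ (by linarith) (by linarith)]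
  nlinarith

lemma continuous_circle {f : ℂ → ℂ} (hf : DifferentiableOn ℂ f (Metric.ball 0 1)) {r : ℝ}
    (hr0 : 0 < r) (hr : r < 1) :
    Continuous fun θ : ℝ => f ((r : ℂ) * Complex.exp ((θ : ℂ) * Complex.I)) := by
  refine hf.continuousOn.comp_continuous (by fun_prop) fun θ => ?_
  simpa [Complex.norm_exp, abs_of_pos hr0] using hr

lemma norm_circle {r : ℝ} (hr0 : 0 < r) (θ : ℝ) :
    ‖(r : ℂ) * Complex.exp ((θ : ℂ) * Complex.I)‖ = r := by
  simp [Complex.norm_exp, abs_of_pos hr0]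

lemma eventually_pos_lt_one : ∀ᶠ r in 𝓝[<] (1 : ℝ), 0 < r ∧ r < 1 :=
  Ioo_mem_nhdsLT one_pos

lemma eventually_circleMean_one_le {p : ℝ≥0∞} (hp : 1 ≤ p) {f : ℂ → ℂ} (hf : f ∈ hardySphere p) :
    ∀ᶠ r in 𝓝[<] (1 : ℝ), circleMean 1 f r ≤ ENNReal.ofReal 2 := by
  have h2 : (1 : ℝ≥0∞) < ENNReal.ofReal 2 := by norm_num
  filter_upwards [hf.2.eventually (gt_mem_nhds h2), eventually_pos_lt_one] with r hr hr1
  exact (MeasureTheory.eLpNorm_le_eLpNorm_of_exponent_le hp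
    (continuous_circle hf.1 hr1.1 hr1.2).aestronglyMeasurable).trans hr.le

/-- Division by a Blaschke product controls the means of the quotient. -/
lemma eventually_circleMean_quotient_le {f P h : ℂ → ℂ} {S : Finset ℂ} (hS : ∀ a ∈ S, ‖a‖ < 1)
    {N C : ℝ} (hN0 : 0 ≤ N) (hC0 : 0 ≤ C)
    (hf : ∀ᶠ r in 𝓝[<] (1 : ℝ), circleMean 1 f r ≤ ENNReal.ofReal N)
    (hP : ∀ z : ℂ, ‖z‖ < 1 → ‖P z‖ ≤ C)
    (hfac : ∀ z ∈ Metric.ball (0 : ℂ) 1, f z - P z = blaschkeProd S z * h z) :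
    ∀ᶠ r in 𝓝[<] (1 : ℝ), circleMean 1 h r ≤ ENNReal.ofReal (2 * (N + C)) := by
  filter_upwards [hf, eventually_pos_lt_one,
    eventually_le_norm_prod_blaschkeFactor S id hS (δ := 1 / 2) (by norm_num)] with r hr hr1 hB
  have hpt : ∀ θ : ℝ, ‖h ((r : ℂ) * Complex.exp ((θ : ℂ) * Complex.I))‖ₑ ≤
      ENNReal.ofReal 2 * (‖f ((r : ℂ) * Complex.exp ((θ : ℂ) * Complex.I))‖ₑ +
        ENNReal.ofReal C) := fun θ => by
    have hnorm := norm_circle hr1.1 θ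
    set w := (r : ℂ) * Complex.exp ((θ : ℂ) * Complex.I)
    have hw1 : ‖w‖ < 1 := hnorm ▸ hr1.2
    have hBw : 1 / 2 ≤ ‖blaschkeProd S w‖ := hB w hnorm
    have h1 : ‖blaschkeProd S w‖ * ‖h w‖ ≤ ‖f w‖ + C := by
      rw [← norm_mul, ← hfac w (mem_ball_zero_iff.2 hw1)]
      exact (norm_sub_le _ _).trans (by gcongr; exact hP w hw1)
    rw [← ofReal_norm, ← ofReal_norm, ← ENNReal.ofReal_add (norm_nonneg _) hC0,
      ← ENNReal.ofReal_mul (by norm_num)]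
    exact ENNReal.ofReal_le_ofReal (by nlinarith [norm_nonneg (h w)])
  rw [circleMean, MeasureTheory.eLpNorm_one_eq_lintegral_enorm] at hr ⊢
  refine (MeasureTheory.lintegral_mono hpt).trans ?_
  rw [MeasureTheory.lintegral_const_mul' _ _ ENNReal.ofReal_ne_top,
    MeasureTheory.lintegral_add_right _ measurable_const, MeasureTheory.lintegral_const,
    MeasureTheory.measure_univ, mul_one, ENNReal.ofReal_mul (by norm_num), ENNReal.ofReal_add hN0 hC0]
  gcongr

/-- Finite Blaschke products have Hardy norm one for every exponent. -/
lemma blaschke_mem_hardySphere {p : ℝ≥0∞} (hp : 1 ≤ p) {n : ℕ} {Z : Fin n → ℂ}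
    (hZ : ∀ j, ‖Z j‖ < 1) : blaschke Z ∈ hardySphere p := by
  have heq : ∀ w, blaschke Z w = ∏ j, blaschkeFactor (Z j) w := fun w => rfl
  have hp0 : p ≠ 0 := (zero_lt_one.trans_le hp).ne'
  have hμ : angleMeasure ≠ 0 := MeasureTheory.IsProbabilityMeasure.ne_zero _
  refine ⟨?_, ?_⟩
  · have : blaschke Z = fun w => ∏ j, blaschkeFactor (Z j) w := rfl
    rw [this]
    exact DifferentiableOn.fun_finsetProd fun j _ => differentiableOn_blaschkeFactor (hZ j)
  have hconst : ∀ c : ℝ, 0 ≤ c → MeasureTheory.eLpNorm (fun _ : ℝ => c) p angleMeasure =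
      ENNReal.ofReal c := fun c hc => by
    rw [MeasureTheory.eLpNorm_const _ hp0 hμ]
    simp [← ofReal_norm, abs_of_nonneg hc]
  unfold HasHardyNorm
  refine tendsto_order.2 ⟨fun b hb => ?_, fun b hb => ?_⟩
  · obtain ⟨c, hc, hc'⟩ := ENNReal.lt_iff_exists_real_btwn.1 hb
    have hc1 : c < 1 := by
      have := hc'.2
      rwa [ENNReal.ofReal_lt_one] at this
    filter_upwards [eventually_pos_lt_one,
      eventually_le_norm_prod_blaschkeFactor Finset.univ Z (fun j _ => hZ j) hc1] with r hr1 hr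
    refine hc'.1.trans_le ?_
    rw [← hconst c hc]
    refine MeasureTheory.eLpNorm_mono fun θ => ?_
    rw [Real.norm_of_nonneg hc, heq]
    exact hr _ (norm_circle hr1.1 θ)
  · filter_upwards [eventually_pos_lt_one] with r hr1
    refine lt_of_le_of_lt ?_ hb
    rw [← ENNReal.ofReal_one, ← hconst 1 zero_le_one]
    refine MeasureTheory.eLpNorm_mono fun θ => ?_
    rw [heq, norm_prod, norm_one]
    exact Finset.prod_le_one (fun _ _ => norm_nonneg _) fun j _ =>
      norm_blaschkeFactor_le_one (hZ j) (by rw [norm_circle hr1.1]; exact hr1.2.le)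

lemma extremalBlaschke_le_extremalHardy {p : ℝ≥0∞} (hp : 1 ≤ p) {E : Set ℂ}
    (hE : E ⊆ Metric.ball 0 1) (ε R : ℝ) : extremalBlaschke E ε R ≤ extremalHardy p E ε R := by
  refine iSup_le fun n => iSup_le fun _ => iSup_le fun Z => iSup_le fun hZ => iSup_le fun hq => ?_
  refine le_iSup₂_of_le (blaschke Z)
    ⟨blaschke_mem_hardySphere hp fun j => mem_ball_zero_iff.1 (hE (hZ j)), fun ζ hζ => ?_⟩ le_rfl
  have h1 : ‖ζ‖ < 1 := mem_ball_zero_iff.1 (hE hζ)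
  have := hq ζ hζ
  rwa [weightedBlaschke, norm_mul, Complex.norm_real, Real.norm_of_nonneg (by linarith)] at this

/-- The square of the weighted Vandermonde-type product of a finite set of points of the disc. -/
noncomputable def weightedEnergy (S : Finset ℂ) : ℝ :=
  (∏ a ∈ S, (1 - ‖a‖) ^ 2) * ∏ x ∈ S.offDiag, ‖blaschkeFactor x.1 x.2‖

lemma weightedEnergy_insert {S : Finset ℂ} {a : ℂ} (ha : a ∉ S) :
    weightedEnergy (insert a S) = ((1 - ‖a‖) * ‖blaschkeProd S a‖) ^ 2 * weightedEnergy S := by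
  have hd1 : Disjoint (S.offDiag ∪ {a} ×ˢ S) (S ×ˢ {a}) := by
    rw [Finset.disjoint_left]
    rintro ⟨x, y⟩ h1 h2
    simp only [Finset.mem_product, Finset.mem_singleton, Finset.mem_union,
      Finset.mem_offDiag] at h1 h2
    rcases h1 with h1 | h1
    · exact ha (h2.2 ▸ h1.2.1)
    · exact ha (h2.2 ▸ h1.2)
  have hd2 : Disjoint S.offDiag ({a} ×ˢ S) := by
    rw [Finset.disjoint_left]
    rintro ⟨x, y⟩ h1 h2
    simp only [Finset.mem_product, Finset.mem_singleton, Finset.mem_offDiag] at h1 h2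
    exact ha (h2.1 ▸ h1.1)
  have h1 : ∏ x ∈ ({a} : Finset ℂ) ×ˢ S, ‖blaschkeFactor x.1 x.2‖ = ‖blaschkeProd S a‖ := by
    rw [Finset.prod_product, Finset.prod_singleton, blaschkeProd, norm_prod]
    exact Finset.prod_congr rfl fun b _ => norm_blaschkeFactor_comm a b
  have h2 : ∏ x ∈ S ×ˢ ({a} : Finset ℂ), ‖blaschkeFactor x.1 x.2‖ = ‖blaschkeProd S a‖ := by
    rw [Finset.prod_product, blaschkeProd, norm_prod]
    simp
  rw [weightedEnergy, weightedEnergy, Finset.prod_insert ha, Finset.offDiag_insert ha,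
    Finset.prod_union hd1, Finset.prod_union hd2, h1, h2]
  ring

lemma weightedEnergy_le_one {S : Finset ℂ} (hS : ∀ a ∈ S, ‖a‖ < 1) : weightedEnergy S ≤ 1 := by
  refine mul_le_one₀ (Finset.prod_le_one (fun _ _ => sq_nonneg _) fun a ha => ?_)
    (Finset.prod_nonneg fun _ _ => norm_nonneg _)
    (Finset.prod_le_one (fun _ _ => norm_nonneg _) fun x hx => ?_)
  · nlinarith [hS a ha, norm_nonneg a]
  · rw [Finset.mem_offDiag] at hx
    exact norm_blaschkeFactor_le_one (hS _ hx.1) (hS _ hx.2.1).le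

lemma weightedEnergy_pos {S : Finset ℂ} (hS : ∀ a ∈ S, ‖a‖ < 1) : 0 < weightedEnergy S := by
  refine mul_pos (Finset.prod_pos fun a ha => ?_) (Finset.prod_pos fun x hx => ?_)
  · have := hS a ha
    have : 0 < 1 - ‖a‖ := by linarith
    positivity
  · rw [Finset.mem_offDiag] at hx
    exact norm_pos_iff.2 (blaschkeFactor_ne_zero (hS _ hx.1) (hS _ hx.2.1).le hx.2.2.symm)

/-- A weighted separated subset of the disc has boundedly many points. -/
lemma card_mul_pow_le_of_separated {S : Finset ℂ} (hS : ∀ a ∈ S, ‖a‖ < 1) {η : ℝ} (hη : 0 < η)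
    (hη1 : η ≤ 1) (hsep : ∀ a ∈ S, η / 2 ≤ (1 - ‖a‖) * ‖blaschkeProd (S.erase a) a‖) :
    (S.card : ℝ) * η ^ 4 ≤ 65 := by
  rcases S.eq_empty_or_nonempty with rfl | ⟨a, ha⟩
  · simp
  have hB : ∀ b ∈ S, ‖blaschkeProd (S.erase b) b‖ ≤ 1 := fun b hb =>
    norm_blaschkeProd_le_one (fun c hc => hS c (Finset.mem_of_mem_erase hc)) (hS b hb).le
  have hq : ∀ b ∈ S, η / 2 ≤ 1 - ‖b‖ := fun b hb =>
    (hsep b hb).trans (mul_le_of_le_one_right (by linarith [hS b hb]) (hB b hb))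
  set n := (S.erase a).card with hn
  have hcard : (S.card : ℝ) = n + 1 := by
    rw [hn, ← Finset.card_erase_add_one ha]
    push_cast
    rfl
  set x := η ^ 2 / 16 with hx
  have hx0 : 0 ≤ x := by positivity
  have hx1 : x ≤ 1 := by
    rw [hx]
    nlinarith
  have h1 : ‖blaschkeProd (S.erase a) a‖ ^ 2 ≤ (1 - x) ^ n := by
    rw [blaschkeProd, norm_prod, ← Finset.prod_pow, hn, ← Finset.prod_const]
    refine Finset.prod_le_prod (fun b _ => sq_nonneg _) fun b hb => ?_
    have hbS := Finset.mem_of_mem_erase hb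
    refine (normSq_blaschkeFactor_le (q := η / 2) (by positivity) (hS b hbS) (hS a ha)
      (hq b hbS) (hq a ha)).trans_eq ?_
    rw [hx]
    ring
  have h2 : η ^ 2 / 4 ≤ (1 - x) ^ n := by
    refine le_trans ?_ h1
    have : η / 2 ≤ ‖blaschkeProd (S.erase a) a‖ :=
      (hsep a ha).trans (mul_le_of_le_one_left (norm_nonneg _) (by linarith [norm_nonneg a]))
    nlinarith
  have h3 : (1 - x) ^ n * (1 + n * x) ≤ 1 := by
    calc (1 - x) ^ n * (1 + n * x) ≤ (1 - x) ^ n * (1 + x) ^ n := by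
          have := one_add_mul_le_pow (a := x) (by linarith) n
          have h0 : 0 ≤ (1 - x) ^ n := pow_nonneg (by linarith) n
          exact mul_le_mul_of_nonneg_left this h0
      _ = (1 - x ^ 2) ^ n := by rw [← mul_pow]; ring
      _ ≤ 1 := pow_le_one₀ (by nlinarith) (by nlinarith)
  have h4 : η ^ 2 / 4 * (1 + n * x) ≤ 1 := le_trans (by gcongr) h3
  have h5 : η ^ 4 ≤ 1 := pow_le_one₀ hη.le hη1
  rw [hcard]
  rw [hx] at h4
  nlinarith [sq_nonneg η]

/-- Near-extremal configurations: a finite subset of `E` which is weighted separated and whose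
weighted Blaschke product is uniformly small on `E`. -/
lemma exists_separated_small {E : Set ℂ} (hE : E ⊆ Metric.ball 0 1) (hinf : E.Infinite) {η : ℝ}
    (hη : 0 < η) (hη1 : η ≤ 1) (hbig : ∃ a ∈ E, η < 1 - ‖a‖) :
    ∃ S : Finset ℂ, ↑S ⊆ E ∧ S.Nonempty ∧
      (∀ ζ ∈ E, (1 - ‖ζ‖) * ‖blaschkeProd S ζ‖ ≤ 2 * η) ∧
      ∀ a ∈ S, η / 2 ≤ (1 - ‖a‖) * ‖blaschkeProd (S.erase a) a‖ := by
  have hdisc : ∀ S : Finset ℂ, ↑S ⊆ E → ∀ a ∈ S, ‖a‖ < 1 := fun S hS a ha =>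
    mem_ball_zero_iff.1 (hE (hS ha))
  set A : ℕ → Set ℝ := fun n => weightedEnergy '' {S | ↑S ⊆ E ∧ S.card = n} with hA
  have hbdd : ∀ n, BddAbove (A n) := fun n => ⟨1, by
    rintro _ ⟨S, hS, rfl⟩
    exact weightedEnergy_le_one (hdisc S hS.1)⟩
  set w : ℕ → ℝ := fun n => sSup (A n)
  have hle : ∀ S : Finset ℂ, ↑S ⊆ E → weightedEnergy S ≤ w S.card := fun S hS =>
    le_csSup (hbdd _) ⟨S, ⟨hS, rfl⟩, rfl⟩
  have hpos : ∀ n, 0 < w n := fun n => by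
    obtain ⟨S, hS, rfl⟩ := hinf.exists_subset_card_eq n
    exact (weightedEnergy_pos (hdisc S hS)).trans_le (hle S hS)
  have hnear : ∀ n, ∃ S : Finset ℂ, ↑S ⊆ E ∧ S.card = n ∧ w n / 4 < weightedEnergy S := fun n => by
    obtain ⟨S₀, hS₀⟩ := hinf.exists_subset_card_eq n
    obtain ⟨_, ⟨S, hS, rfl⟩, h⟩ := exists_lt_of_lt_csSup (s := A n) ⟨_, S₀, hS₀, rfl⟩
      (show w n / 4 < sSup (A n) by linarith [hpos n, show sSup (A n) = w n from rfl])
    exact ⟨S, hS.1, hS.2, h⟩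
  have hsep : ∀ n, η ^ 2 * w n < w (n + 1) → ∀ S : Finset ℂ, ↑S ⊆ E → S.card = n + 1 →
      w (n + 1) / 4 < weightedEnergy S →
      ∀ a ∈ S, η / 2 ≤ (1 - ‖a‖) * ‖blaschkeProd (S.erase a) a‖ := by
    intro n hn S hS hcard hlarge a ha
    have hS' : ↑(S.erase a) ⊆ E := fun b hb => hS (Finset.mem_of_mem_erase hb)
    have h1 := hle _ hS'
    rw [Finset.card_erase_of_mem ha, hcard, Nat.add_sub_cancel] at h1
    have h2 := weightedEnergy_insert (Finset.notMem_erase a S)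
    rw [Finset.insert_erase ha] at h2
    have h3 := weightedEnergy_pos (hdisc _ hS')
    have h4 : (η / 2) ^ 2 < ((1 - ‖a‖) * ‖blaschkeProd (S.erase a) a‖) ^ 2 := by
      refine lt_of_mul_lt_mul_right ?_ h3.le
      rw [← h2]
      nlinarith [sq_nonneg η]
    exact (lt_of_pow_lt_pow_left₀ 2 (mul_nonneg (by linarith [hdisc S hS a ha])
      (norm_nonneg _)) h4).le
  have hexists : ∃ n, w (n + 1) ≤ η ^ 2 * w n := by
    by_contra! hcon
    obtain ⟨n, hn⟩ := exists_nat_gt (65 / η ^ 4)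
    obtain ⟨S, hS, hcard, hlarge⟩ := hnear (n + 1)
    have h1 := card_mul_pow_le_of_separated (hdisc S hS) hη hη1 (hsep n (hcon n) S hS hcard hlarge)
    rw [div_lt_iff₀ (by positivity)] at hn
    rw [hcard] at h1
    push_cast at h1
    nlinarith [pow_pos hη 4]
  classical
  have hfind := Nat.find_spec hexists
  have hmin : ∀ m < Nat.find hexists, η ^ 2 * w m < w (m + 1) := fun m hm =>
    not_le.1 (Nat.find_min hexists hm)
  set n := Nat.find hexists
  have hn0 : n ≠ 0 := fun h0 => by
    obtain ⟨a, haE, ha⟩ := hbig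
    rw [h0] at hfind
    have h1 : w 0 ≤ 1 := csSup_le ⟨_, ∅, by simp, rfl⟩ (by
      rintro _ ⟨S, hS, rfl⟩
      exact weightedEnergy_le_one (hdisc S hS.1))
    have h2 := hle {a} (by simpa using haE)
    have h3 : weightedEnergy {a} = (1 - ‖a‖) ^ 2 := by simp [weightedEnergy]
    rw [h3, Finset.card_singleton] at h2
    nlinarith
  obtain ⟨m, hm⟩ := Nat.exists_eq_succ_of_ne_zero hn0
  obtain ⟨S, hS, hcard, hlarge⟩ := hnear n
  refine ⟨S, hS, Finset.card_ne_zero.1 (hcard ▸ hn0), fun ζ hζ => ?_, ?_⟩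
  · by_cases hζS : ζ ∈ S
    · rw [blaschkeProd_eq_zero hζS]
      simpa using hη.le
    have h1 := hle (insert ζ S) (by
      rw [Finset.coe_insert]
      exact Set.insert_subset hζ hS)
    rw [Finset.card_insert_of_notMem hζS, hcard, weightedEnergy_insert hζS] at h1
    have h3 := weightedEnergy_pos (hdisc _ hS)
    have h4 : ((1 - ‖ζ‖) * ‖blaschkeProd S ζ‖) ^ 2 ≤ (2 * η) ^ 2 := by
      refine le_of_mul_le_mul_right (h1.trans (hfind.trans ?_)) h3
      nlinarith [sq_nonneg η]
    exact le_of_sq_le_sq h4 (by positivity)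
  · rw [hm] at hcard hlarge
    exact hsep m (hmin m (by omega)) S hS hcard hlarge

lemma blaschkeProd_eq_mul_erase {S : Finset ℂ} {a : ℂ} (ha : a ∈ S) (z : ℂ) :
    blaschkeProd S z = blaschkeFactor a z * blaschkeProd (S.erase a) z :=
  (Finset.mul_prod_erase S (fun b => blaschkeFactor b z) ha).symm

/-- Removing one zero does not enlarge a Blaschke product much on a smaller disc. -/
lemma norm_blaschkeProd_erase_le {S : Finset ℂ} (hS : ∀ a ∈ S, ‖a‖ < 1) {R M : ℝ} (hR0 : 0 < R)
    (hR1 : R < 1) (hM : ∀ z : ℂ, ‖z‖ ≤ R → ‖blaschkeProd S z‖ ≤ M) {a : ℂ} (ha : a ∈ S) {z : ℂ}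
    (hz : ‖z‖ ≤ R / 3) : ‖blaschkeProd (S.erase a) z‖ ≤ 12 / R * M := by
  have hfar : ∀ w : ℂ, ‖w‖ ≤ R → R / 6 ≤ ‖w - a‖ → ‖blaschkeProd (S.erase a) w‖ ≤ 12 / R * M := by
    intro w hw hwa
    have h1 := le_norm_blaschkeFactor_of_norm_sub_ge (hS a ha) (hw.trans hR1.le) hwa
    have h2 := hM w hw
    rw [blaschkeProd_eq_mul_erase ha, norm_mul] at h2
    rw [div_mul_eq_mul_div, le_div_iff₀ hR0]
    nlinarith [norm_nonneg (blaschkeProd (S.erase a) w)]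
  rcases le_total (R / 2) ‖a‖ with haR | haR
  · refine hfar z (by linarith) ?_
    have := norm_sub_norm_le a z
    rw [norm_sub_rev]
    linarith
  · have hr : (0 : ℝ) < 2 * R / 3 := by positivity
    have hd : DiffContOnCl ℂ (blaschkeProd (S.erase a)) (Metric.ball 0 (2 * R / 3)) :=
      ((differentiableOn_blaschkeProd fun b hb => hS b (Finset.mem_of_mem_erase hb)).mono
        (Metric.closedBall_subset_ball (by linarith))).diffContOnCl_ball subset_rfl
    refine Complex.norm_le_of_forall_mem_frontier_norm_le Metric.isBounded_ball hd
      (fun w hw => ?_) (by rw [closure_ball _ hr.ne', mem_closedBall_zero_iff]; linarith)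
    have hw : ‖w‖ = 2 * R / 3 := by
      rw [frontier_ball _ hr.ne'] at hw
      simpa using hw
    refine hfar w (by linarith) ?_
    have := norm_sub_norm_le w a
    linarith

/-- The Lagrange interpolant of `f` at the points of `S`, built from Blaschke products. -/
noncomputable def lagrangeBlaschke (S : Finset ℂ) (f : ℂ → ℂ) (z : ℂ) : ℂ :=
  ∑ a ∈ S, f a / blaschkeProd (S.erase a) a * blaschkeProd (S.erase a) z

lemma differentiableOn_lagrangeBlaschke {S : Finset ℂ} (hS : ∀ a ∈ S, ‖a‖ < 1) (f : ℂ → ℂ) :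
    DifferentiableOn ℂ (lagrangeBlaschke S f) (Metric.ball 0 1) := by
  unfold lagrangeBlaschke
  exact DifferentiableOn.fun_sum fun a _ => (differentiableOn_blaschkeProd fun b hb =>
    hS b (Finset.mem_of_mem_erase hb)).const_mul _

lemma lagrangeBlaschke_apply {S : Finset ℂ} (hS : ∀ a ∈ S, ‖a‖ < 1) (f : ℂ → ℂ) {a : ℂ}
    (ha : a ∈ S) : lagrangeBlaschke S f a = f a := by
  rw [lagrangeBlaschke, Finset.sum_eq_single_of_mem a ha, div_mul_cancel₀]
  · exact Finset.prod_ne_zero_iff.2 fun b hb => blaschkeFactor_ne_zero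
      (hS b (Finset.mem_of_mem_erase hb)) (hS a ha).le (Finset.ne_of_mem_erase hb).symm
  · intro b _ hba
    rw [blaschkeProd_eq_zero (Finset.mem_erase.2 ⟨hba.symm, ha⟩), mul_zero]

lemma norm_lagrangeBlaschke_le {S : Finset ℂ} (hS : ∀ a ∈ S, ‖a‖ < 1) {f : ℂ → ℂ} {η : ℝ}
    (hη : 0 < η) (hη1 : η ≤ 1)
    (hsep : ∀ a ∈ S, η / 2 ≤ (1 - ‖a‖) * ‖blaschkeProd (S.erase a) a‖)
    (hf : ∀ a ∈ S, (1 - ‖a‖) * ‖f a‖ ≤ (2 * η) ^ 5) {z : ℂ} {B : ℝ}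
    (hB : ∀ a ∈ S, ‖blaschkeProd (S.erase a) z‖ ≤ B) (hB0 : 0 ≤ B) :
    ‖lagrangeBlaschke S f z‖ ≤ 4160 * B := by
  have hcoef : ∀ a ∈ S, ‖f a / blaschkeProd (S.erase a) a‖ ≤ 64 * η ^ 4 := fun a ha => by
    have h1 := hsep a ha
    have h2 := hf a ha
    have h3 : 0 < 1 - ‖a‖ := by linarith [hS a ha]
    have h4 : 0 < ‖blaschkeProd (S.erase a) a‖ := by
      by_contra! hcon
      nlinarith
    rw [norm_div, div_le_iff₀ h4]
    have h5 : ‖f a‖ * (η / 2) ≤ (2 * η) ^ 5 * ‖blaschkeProd (S.erase a) a‖ := by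
      calc ‖f a‖ * (η / 2) ≤ ‖f a‖ * ((1 - ‖a‖) * ‖blaschkeProd (S.erase a) a‖) := by gcongr
        _ = (1 - ‖a‖) * ‖f a‖ * ‖blaschkeProd (S.erase a) a‖ := by ring
        _ ≤ _ := by gcongr
    refine le_of_mul_le_mul_right (h5.trans_eq ?_) (half_pos hη)
    ring
  calc ‖lagrangeBlaschke S f z‖ ≤ ∑ a ∈ S, 64 * η ^ 4 * B := by
        refine norm_sum_le_of_le _ fun a ha => ?_
        rw [norm_mul]
        exact mul_le_mul (hcoef a ha) (hB a ha) (norm_nonneg _) (by positivity)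
    _ = 64 * (S.card * η ^ 4) * B := by rw [Finset.sum_const, nsmul_eq_mul]; ring
    _ ≤ 4160 * B := by
        have := card_mul_pow_le_of_separated hS hη hη1 hsep
        gcongr
        linarith

/-- Comparison of a function of the Hardy sphere, small on a separated set, with the corresponding
Blaschke product. -/
lemma norm_le_mul_of_separated {S : Finset ℂ} (hS : ∀ a ∈ S, ‖a‖ < 1) {p : ℝ≥0∞} (hp : 1 ≤ p)
    {f : ℂ → ℂ} (hf : f ∈ hardySphere p) {η : ℝ} (hη : 0 < η) (hη1 : η ≤ 1)
    (hsep : ∀ a ∈ S, η / 2 ≤ (1 - ‖a‖) * ‖blaschkeProd (S.erase a) a‖)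
    (hfS : ∀ a ∈ S, (1 - ‖a‖) * ‖f a‖ ≤ (2 * η) ^ 5) {R M : ℝ} (hR0 : 0 < R) (hR1 : R < 1)
    (hM : ∀ z : ℂ, ‖z‖ ≤ R → ‖blaschkeProd S z‖ ≤ M) {z : ℂ} (hz : ‖z‖ ≤ R / 3) :
    ‖f z‖ ≤ (49920 / R + 24972) * M := by
  have hM0 : 0 ≤ M := (norm_nonneg _).trans (hM 0 (by simpa using hR0.le))
  have hP : ∀ z : ℂ, ‖z‖ < 1 → ‖lagrangeBlaschke S f z‖ ≤ 4160 := fun z hz => by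
    simpa using norm_lagrangeBlaschke_le hS hη hη1 hsep hfS (z := z) (B := 1)
      (fun a _ => norm_blaschkeProd_le_one (fun b hb => hS b (Finset.mem_of_mem_erase hb)) hz.le)
      zero_le_one
  obtain ⟨h, hh, hfac⟩ := exists_eq_blaschkeProd_mul hS
    (f := fun z => f z - lagrangeBlaschke S f z)
    (hf.1.sub (differentiableOn_lagrangeBlaschke hS f))
    fun a ha => by rw [lagrangeBlaschke_apply hS f ha, sub_self]
  have hmean := eventually_circleMean_quotient_le hS (by norm_num) (by norm_num)
    (eventually_circleMean_one_le hp hf) hP hfac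
  have hhz := norm_le_of_eventually_circleMean_le hh (ρ := 1 / 3) (by norm_num) hmean (by norm_num)
    (z := z) (by linarith)
  have hPz := norm_lagrangeBlaschke_le hS hη hη1 hsep hfS (z := z) (B := 12 / R * M)
    (fun a ha => norm_blaschkeProd_erase_le hS hR0 hR1 hM ha hz) (by positivity)
  have hfz := hfac z (mem_ball_zero_iff.2 (by linarith))
  have hBz := hM z (by linarith)
  calc ‖f z‖ = ‖lagrangeBlaschke S f z + blaschkeProd S z * h z‖ := by rw [← hfz]; ring_nf
    _ ≤ 4160 * (12 / R * M) + M * 24972 := by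
        refine (norm_add_le _ _).trans (add_le_add hPz ?_)
        rw [norm_mul]
        exact mul_le_mul hBz (hhz.trans (by norm_num)) (norm_nonneg _) hM0
    _ = _ := by ring

lemma supOnDisc_le_extremalBlaschke {E : Set ℂ} (hE : E ⊆ Metric.ball 0 1) {S : Finset ℂ}
    (hSE : ↑S ⊆ E) (hne : S.Nonempty) {δ : ℝ}
    (hsmall : ∀ ζ ∈ E, (1 - ‖ζ‖) * ‖blaschkeProd S ζ‖ ≤ δ) (R : ℝ) :
    supOnDisc R (blaschkeProd S) ≤ extremalBlaschke E δ R := by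
  have heq : blaschke (fun j => (S.equivFin.symm j : ℂ)) = blaschkeProd S := funext fun w => by
    rw [blaschkeProd, ← Finset.prod_coe_sort]
    exact S.equivFin.symm.prod_comp fun a : S => blaschkeFactor a w
  rw [← heq]
  refine le_iSup_of_le S.card (le_iSup_of_le hne.card_pos (le_iSup_of_le _ (le_iSup_of_le
    (fun j => hSE (S.equivFin.symm j).2) (le_iSup_of_le (fun ζ hζ => ?_) le_rfl))))
  have h1 : ‖ζ‖ < 1 := mem_ball_zero_iff.1 (hE hζ)
  rw [weightedBlaschke, norm_mul, Complex.norm_real, Real.norm_of_nonneg (by linarith), heq]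
  exact hsmall ζ hζ

/-- The exponent coming from the three circles of radii `R / 3 < R < (1 + R) / 2`. -/
noncomputable def circleExponent (R : ℝ) : ℝ := Real.log 3 / Real.log (3 * (1 + R) / (2 * R))

lemma circleExponent_pos_lt_one {R : ℝ} (hR0 : 0 < R) (hR1 : R < 1) :
    0 < circleExponent R ∧ circleExponent R < 1 := by
  have h3 : 3 < 3 * (1 + R) / (2 * R) := by
    rw [lt_div_iff₀ (by positivity)]
    linarith
  have hlog3 : 0 < Real.log 3 := Real.log_pos (by norm_num)
  have hlog : Real.log 3 < Real.log (3 * (1 + R) / (2 * R)) := Real.log_lt_log (by norm_num) h3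
  exact ⟨div_pos hlog3 (hlog3.trans hlog), (div_lt_one (hlog3.trans hlog)).2 hlog⟩

lemma norm_le_of_mem_hardySphere {p : ℝ≥0∞} (hp : 1 ≤ p) {f : ℂ → ℂ} (hf : f ∈ hardySphere p)
    {ρ : ℝ} (hρ : ρ < 1) {z : ℂ} (hz : ‖z‖ ≤ ρ) : ‖f z‖ ≤ 4 / (1 - ρ) :=
  (norm_le_of_eventually_circleMean_le hf.1 (by norm_num) (eventually_circleMean_one_le hp hf) hρ
    hz).trans_eq (by norm_num)

lemma norm_le_rpow_of_norm_le {p : ℝ≥0∞} (hp : 1 ≤ p) {f : ℂ → ℂ} (hf : f ∈ hardySphere p)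
    {R a : ℝ} (hR0 : 0 < R) (hR1 : R < 1) (ha : ∀ z : ℂ, ‖z‖ ≤ R / 3 → ‖f z‖ ≤ a) {z : ℂ}
    (hz : ‖z‖ ≤ R) :
    ‖f z‖ ≤ a ^ (1 - circleExponent R) * (8 / (1 - R)) ^ circleExponent R := by
  have h := norm_le_of_three_circles hf.1 (r := R / 3) (R := R) (ρ := (1 + R) / 2) (a := a)
    (b := 8 / (1 - R)) (by positivity) (by linarith) (by linarith) (by linarith)
    (fun w hw => ha w hw.le) (fun w hw => ?_) hz
  · have e1 : R / (R / 3) = 3 := by field_simp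
    have e2 : (1 + R) / 2 / (R / 3) = 3 * (1 + R) / (2 * R) := by field_simp
    rwa [e1, e2] at h
  · refine (norm_le_of_mem_hardySphere hp hf (ρ := (1 + R) / 2) (by linarith) hw.le).trans_eq ?_
    rw [div_eq_div_iff (by linarith) (by linarith)]
    ring

lemma supOnDisc_blaschkeProd_le_one {S : Finset ℂ} (hS : ∀ a ∈ S, ‖a‖ < 1) {R : ℝ} (hR : R < 1) :
    supOnDisc R (blaschkeProd S) ≤ 1 := by
  refine iSup₂_le fun z hz => ?_
  rw [← ofReal_norm, ENNReal.ofReal_le_one]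
  exact norm_blaschkeProd_le_one hS ((mem_closedBall_zero_iff.1 hz).trans hR.le)

/-- The multiplicative constant of the comparison theorem. -/
noncomputable def comparisonConstant (R : ℝ) : ℝ :=
  (49920 / R + 24972) ^ (1 - circleExponent R) * (8 / (1 - R)) ^ circleExponent R +
    4 / (1 - R) * 2 ^ (1 - circleExponent R)

lemma comparisonConstant_pos {R : ℝ} (hR0 : 0 < R) (hR1 : R < 1) : 0 < comparisonConstant R := by
  have : 0 < 1 - R := by linarith
  unfold comparisonConstant
  positivity

lemma exists_finset_norm_le {E : Set ℂ} (hE : E ⊆ Metric.ball 0 1) (hinf : E.Infinite)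
    {p : ℝ≥0∞} (hp : 1 ≤ p) {R : ℝ} (hR0 : 0 < R) (hR1 : R < 1) {η : ℝ} (hη : 0 < η)
    (hη1 : η ≤ 1 / 2) :
    ∃ S : Finset ℂ, ↑S ⊆ E ∧ S.Nonempty ∧
      (∀ ζ ∈ E, (1 - ‖ζ‖) * ‖blaschkeProd S ζ‖ ≤ 2 * η) ∧
      ∀ f ∈ hardySphere p, (∀ ζ ∈ E, (1 - ‖ζ‖) * ‖f ζ‖ ≤ (2 * η) ^ 5) → ∀ z : ℂ, ‖z‖ ≤ R →
        ‖f z‖ ≤ comparisonConstant R *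
          (supOnDisc R (blaschkeProd S)).toReal ^ (1 - circleExponent R) := by
  have hR : 0 < 1 - R := by linarith
  have hdisc : ∀ S : Finset ℂ, ↑S ⊆ E → ∀ a ∈ S, ‖a‖ < 1 := fun S hS a ha =>
    mem_ball_zero_iff.1 (hE (hS ha))
  obtain ⟨hθ0, hθ1⟩ := circleExponent_pos_lt_one hR0 hR1
  have hM : ∀ S : Finset ℂ, ↑S ⊆ E → ∀ z : ℂ, ‖z‖ ≤ R →
      ‖blaschkeProd S z‖ ≤ (supOnDisc R (blaschkeProd S)).toReal := fun S hS z hz => by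
    have hfin : supOnDisc R (blaschkeProd S) ≠ ⊤ :=
      ((supOnDisc_blaschkeProd_le_one (hdisc S hS) hR1).trans_lt ENNReal.one_lt_top).ne
    rw [← toReal_enorm]
    exact ENNReal.toReal_mono hfin
      (le_iSup₂_of_le (f := fun w (_ : w ∈ Metric.closedBall (0 : ℂ) R) => ‖blaschkeProd S w‖ₑ) z
        (mem_closedBall_zero_iff.2 hz) le_rfl)
  by_cases hbig : ∃ a ∈ E, η < 1 - ‖a‖
  · obtain ⟨S, hSE, hne, hsmall, hsep⟩ :=
      exists_separated_small hE hinf hη (by linarith) hbig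
    refine ⟨S, hSE, hne, hsmall, fun f hf hfE z hz => ?_⟩
    have h1 := norm_le_rpow_of_norm_le hp hf hR0 hR1 (fun w hw =>
      norm_le_mul_of_separated (hdisc S hSE) hp hf hη (by linarith) hsep
        (fun a ha => hfE a (hSE ha)) hR0 hR1 (hM S hSE) hw) hz
    rw [Real.mul_rpow (by positivity) ENNReal.toReal_nonneg] at h1
    refine h1.trans ?_
    rw [comparisonConstant, mul_right_comm]
    gcongr
    exact le_add_of_nonneg_right (by positivity)
  · push Not at hbig
    obtain ⟨a, ha⟩ := hinf.nonempty
    have haE : (↑({a} : Finset ℂ) : Set ℂ) ⊆ E := by simpa using ha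
    refine ⟨{a}, haE, by simp, fun ζ hζ => ?_, fun f hf _ z hz => ?_⟩
    · have h1 := norm_blaschkeProd_le_one (hdisc {a} haE) (mem_ball_zero_iff.1 (hE hζ)).le
      nlinarith [hbig ζ hζ, mem_ball_zero_iff.1 (hE hζ), norm_nonneg (blaschkeProd {a} ζ)]
    · have h1 : 1 / 2 ≤ (supOnDisc R (blaschkeProd {a})).toReal := by
        refine le_trans ?_ (hM {a} haE 0 (by simpa using hR0.le))
        simp only [blaschkeProd, Finset.prod_singleton, blaschkeFactor, zero_sub, mul_zero,
          sub_zero, div_one, norm_neg]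
        linarith [hbig a ha]
      have h2 : 1 ≤ 2 ^ (1 - circleExponent R) *
          (supOnDisc R (blaschkeProd {a})).toReal ^ (1 - circleExponent R) := by
        rw [← Real.mul_rpow (by norm_num) ENNReal.toReal_nonneg]
        exact Real.one_le_rpow (by linarith) (by linarith)
      calc ‖f z‖ ≤ 4 / (1 - R) := norm_le_of_mem_hardySphere hp hf hR1 hz
        _ ≤ 4 / (1 - R) * (2 ^ (1 - circleExponent R) *
            (supOnDisc R (blaschkeProd {a})).toReal ^ (1 - circleExponent R)) :=
          le_mul_of_one_le_right (by positivity) h2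
        _ ≤ _ := by
          rw [comparisonConstant, ← mul_assoc]
          gcongr
          exact le_add_of_nonneg_left (by positivity)

lemma extremalHardy_le {E : Set ℂ} (hE : E ⊆ Metric.ball 0 1) (hinf : E.Infinite)
    {p : ℝ≥0∞} (hp : 1 ≤ p) {R : ℝ} (hR0 : 0 < R) (hR1 : R < 1) {ε : ℝ} (hε : 0 < ε)
    (hε1 : ε < 1) :
    extremalHardy p E ε R ≤ ENNReal.ofReal (comparisonConstant R) *
      extremalBlaschke E (ε ^ (1 / 5 : ℝ)) R ^ (1 - circleExponent R) := by
  have hα : 0 ≤ 1 - circleExponent R := by linarith [(circleExponent_pos_lt_one hR0 hR1).2]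
  set t := ε ^ (1 / 5 : ℝ) with ht
  have ht0 : 0 < t := Real.rpow_pos_of_pos hε _
  have ht1 : t ≤ 1 := Real.rpow_le_one hε.le hε1.le (by norm_num)
  have ht5 : t ^ 5 = ε := by
    rw [ht, ← Real.rpow_natCast, ← Real.rpow_mul hε.le]
    norm_num
  obtain ⟨S, hSE, hne, hsmall, hbound⟩ := exists_finset_norm_le hE hinf hp hR0 hR1
    (half_pos ht0) (by linarith)
  rw [mul_div_cancel₀ t two_ne_zero, ht5] at hbound
  rw [mul_div_cancel₀ t two_ne_zero] at hsmall
  have hfin : supOnDisc R (blaschkeProd S) ≠ ⊤ :=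
    ((supOnDisc_blaschkeProd_le_one (fun a ha => mem_ball_zero_iff.1 (hE (hSE ha))) hR1).trans_lt
      ENNReal.one_lt_top).ne
  refine iSup₂_le fun f hf => iSup₂_le fun z hz => ?_
  calc ‖f z‖ₑ ≤ ENNReal.ofReal (comparisonConstant R *
        (supOnDisc R (blaschkeProd S)).toReal ^ (1 - circleExponent R)) := by
        rw [← ofReal_norm]
        exact ENNReal.ofReal_le_ofReal (hbound f hf.1 hf.2 z (mem_closedBall_zero_iff.1 hz))
    _ = ENNReal.ofReal (comparisonConstant R) *
        supOnDisc R (blaschkeProd S) ^ (1 - circleExponent R) := by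
        rw [ENNReal.ofReal_mul (comparisonConstant_pos hR0 hR1).le,
          ← ENNReal.ofReal_rpow_of_nonneg ENNReal.toReal_nonneg hα, ENNReal.ofReal_toReal hfin]
    _ ≤ _ := by
        gcongr
        exact supOnDisc_le_extremalBlaschke hE hSE hne hsmall R

end HardyBlaschke

theorem theorem1 :
    ∃ σ : ℝ, 0 < σ ∧
      ∀ (p : ℝ≥0∞) (R : ℝ), 1 ≤ p → 0 < R → R < 1 →
        ∃ K α ε₀ : ℝ, 0 < K ∧ 0 < α ∧ 0 < ε₀ ∧
          ∀ (E : Set ℂ) (ε : ℝ), HardyBlaschke.IsNonBlaschke E → 0 < ε → ε < ε₀ →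
            HardyBlaschke.extremalBlaschke E ε R ≤ HardyBlaschke.extremalHardy p E ε R ∧
            HardyBlaschke.extremalHardy p E ε R ≤
              ENNReal.ofReal K * (HardyBlaschke.extremalBlaschke E (ε ^ σ) R) ^ α := by
  refine ⟨1 / 5, by norm_num, fun p R hp hR0 hR1 => ⟨HardyBlaschke.comparisonConstant R,
    1 - HardyBlaschke.circleExponent R, 1, HardyBlaschke.comparisonConstant_pos hR0 hR1,
    by linarith [(HardyBlaschke.circleExponent_pos_lt_one hR0 hR1).2], one_pos,
    fun E ε hE hε hε1 => ⟨HardyBlaschke.extremalBlaschke_le_extremalHardy hp hE.1 ε R, ?_⟩⟩⟩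
  obtain ⟨z, hz, hzE, -⟩ := hE.2
  exact HardyBlaschke.extremalHardy_le hE.1 (Set.infinite_of_injective_forall_mem hz hzE) hp hR0
    hR1 hε hε1
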